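/- Let $\mathbb{K}$ be a field and let $G$ be a finite simple graph with vertex set $V(G)=\{x_1,\dots,x_n\}$. Let $R=\mathbb{K}[x_1,\dots,x_n]$, let $\Delta_G$ be the independence complex of $G$ (the simplicial complex of all independent sets of $G$), and let $\mathbb{K}[\Delta_G]=R/I_{\Delta_G}$ be its Stanley–Reisner ring, where $I_{\Delta_G}$ is generated by the squarefree monomials $x_F=\prod_{x_i\in F}x_i$ with $F\subseteq V(G)$, $F\notin\Delta_G$. Suppose that $G$ has a full-vertex, i.e. a vertex $x$ that is adjacent to every other vertex of $G$. Then the projective dimension of $\mathbb{K}[\Delta_G]$ as an $R$-module satisfies $$\operatorname{pdim}\mathbb{K}[\Delta_G]=\max_{1\le i\le n}\{\deg_G(x_i)\}=n-1.$$ -/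

import Mathlib

/-- The Stanley-Reisner ideal of a simplicial complex `Δ` on the vertex set `V`: the ideal of
`K[x_v | v ∈ V]` generated by the squarefree monomials `x_F = ∏_{v ∈ F} x_v`, `F` a non-face of `Δ`.
(Mathlib's simplicial complexes do not list the empty set among the faces; it is always a face in
the usual convention, so only the nonempty non-faces give generators.) -/
noncomputable def stanleyReisnerIdeal (K : Type*) [Field K] {V : Type*} (Δ : AbstractSimplicialComplex V) :
    Ideal (MvPolynomial V K) :=
  Ideal.span {p | ∃ F : Finset V, F.Nonempty ∧ F ∉ Δ.faces ∧ p = ∏ v ∈ F, MvPolynomial.X v}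

/-- The Stanley-Reisner ring `K[Δ]`. -/
noncomputable abbrev StanleyReisnerRing (K : Type*) [Field K] {V : Type*} (Δ : AbstractSimplicialComplex V) :
    Type _ :=
  MvPolynomial V K ⧸ stanleyReisnerIdeal K Δ

/-- The independence complex `Δ_G` of a graph `G`: its faces are the (nonempty) finite independent
sets of vertices. -/
def independenceComplex {V : Type*} (G : SimpleGraph V) : AbstractSimplicialComplex V where
  faces := {F | F.Nonempty ∧ G.IsIndepSet (F : Set V)}
  isRelLowerSet_faces := fun _ hF =>
    ⟨hF.1, fun _ hsub hne => ⟨hne, hF.2.mono (Finset.coe_subset.2 hsub)⟩⟩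
  singleton_mem := fun v => ⟨Finset.singleton_nonempty v, by simp [SimpleGraph.IsIndepSet]⟩

/-- The projective dimension of `K[Δ]` as a module over the polynomial ring `K[x_v | v ∈ V]`. -/
noncomputable def pdimStanleyReisner (K : Type*) [Field K] {V : Type*}
    (Δ : AbstractSimplicialComplex V) : WithBot ℕ∞ :=
  CategoryTheory.projectiveDimension
    (ModuleCat.of (MvPolynomial V K) (StanleyReisnerRing K Δ))

/-! The Stanley–Reisner ideal is the edge ideal. Upper bound: adjoin to it the variables of a proper
subset `A` of `V`, and induct on the size of the complement of `A`. If `A` covers every edge, the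
ideal is generated by the variables of `A`, and the quotient has projective dimension at most `|A| <
n`. Otherwise an uncovered edge `yz` gives `0 → R/(J : y) → R/J → R/(J + (y)) → 0`, whose outer
ideals have the same form with larger proper subsets. Lower bound: localize at a prime containing
every variable except that of the full-vertex `x`. The edge ideal becomes generated by a regular
sequence of length `n - 1`, and localization does not raise projective dimension. -/

open CategoryTheory MvPolynomial

section ColonSequence

universe u

variable {R : Type u} [CommRing R] {I J L : Ideal R} {y : R}

/-- The sequence `R ⧸ (J : y) → R ⧸ J → R ⧸ (J + (y))`, whose first map is multiplication by `y`. -/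
noncomputable def colonShortComplex (hI : ∀ f, f ∈ I ↔ y * f ∈ J) (hL : L = J ⊔ Ideal.span {y}) :
    ShortComplex (ModuleCat.{u} R) :=
  ModuleCat.shortComplexOfCompEqZero
    (Submodule.mapQ I J (LinearMap.lsmul R R y) fun f hf => (hI f).1 hf)
    (Submodule.factor (hL ▸ le_sup_left : J ≤ L)) <| by
      refine Submodule.linearMap_qext _ (LinearMap.ext fun f => ?_)
      have : y * f ∈ L := hL ▸ Ideal.mul_mem_right _ _
        (Ideal.mem_sup_right (Ideal.mem_span_singleton_self y))
      exact (Submodule.Quotient.mk_eq_zero L).2 this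

theorem colonShortComplex_shortExact (hI : ∀ f, f ∈ I ↔ y * f ∈ J)
    (hL : L = J ⊔ Ideal.span {y}) : (colonShortComplex hI hL).ShortExact where
  exact := by
    refine ModuleCat.shortComplex_exact _ fun f => ⟨fun hf => ?_, ?_⟩
    · obtain ⟨f, rfl⟩ := Submodule.Quotient.mk_surjective _ f
      have hf' : f ∈ J ⊔ Ideal.span {y} := hL ▸ (Submodule.Quotient.mk_eq_zero L).1 hf
      obtain ⟨a, ha, b, hb, rfl⟩ := Submodule.mem_sup.1 hf'
      obtain ⟨c, rfl⟩ := Ideal.mem_span_singleton.1 hb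
      refine ⟨Submodule.Quotient.mk c, (Submodule.Quotient.eq J).2 ?_⟩
      simpa using ha
    · rintro ⟨g, rfl⟩
      exact congr($((colonShortComplex hI hL).zero).hom g)
  mono_f := by
    refine (ModuleCat.mono_iff_injective _).2 ((injective_iff_map_eq_zero _).2 fun f hf => ?_)
    obtain ⟨f, rfl⟩ := Submodule.Quotient.mk_surjective _ f
    exact (Submodule.Quotient.mk_eq_zero I).2
      ((hI f).2 ((Submodule.Quotient.mk_eq_zero J).1 hf))
  epi_g := (ModuleCat.epi_iff_surjective _).2 (Submodule.factor_surjective (hL ▸ le_sup_left))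

end ColonSequence

section EdgeIdeal

variable (K : Type*) [Field K] {V : Type*}

/-- The ideal generated by the edge ideal of `G` and the variables in `A`. -/
noncomputable def edgeVarIdeal (G : SimpleGraph V) (A : Set V) : Ideal (MvPolynomial V K) :=
  Ideal.span (X '' A ∪ {p | ∃ a b, G.Adj a b ∧ p = X a * X b})

variable {K}

theorem mem_edgeVarIdeal {G : SimpleGraph V} {A : Set V} {f : MvPolynomial V K} :
    f ∈ edgeVarIdeal K G A ↔ ∀ d ∈ f.support,
      (∃ a ∈ A, d a ≠ 0) ∨ ∃ a b, G.Adj a b ∧ d a ≠ 0 ∧ d b ≠ 0 := by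
  classical
  have h : X '' A ∪ {p | ∃ a b, G.Adj a b ∧ p = X a * X b} = (fun s => monomial s (1 : K)) ''
      ((fun a => Finsupp.single a 1) '' A ∪
        {s | ∃ a b, G.Adj a b ∧ s = Finsupp.single a 1 + Finsupp.single b 1}) := by
    rw [Set.image_union, Set.image_image]
    congr 1
    ext p
    constructor
    · rintro ⟨a, b, hab, rfl⟩
      exact ⟨_, ⟨a, b, hab, rfl⟩, by simp [X, monomial_mul]⟩
    · rintro ⟨_, ⟨a, b, hab, rfl⟩, rfl⟩
      exact ⟨a, b, hab, by simp [X, monomial_mul]⟩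
  rw [edgeVarIdeal, h, mem_ideal_span_monomial_image]
  refine forall₂_congr fun d _ => ⟨?_, ?_⟩
  · rintro ⟨_, ⟨a, ha, rfl⟩ | ⟨a, b, hab, rfl⟩, hs⟩
    · exact .inl ⟨a, ha, by simpa [Nat.one_le_iff_ne_zero] using hs⟩
    · refine .inr ⟨a, b, hab, ?_, ?_⟩
      · have := hs a
        simp [hab.ne'] at this
        omega
      · have := hs b
        simp [hab.ne] at this
        omega
  · rintro (⟨a, ha, h⟩ | ⟨a, b, hab, ha, hb⟩)
    · exact ⟨_, .inl ⟨a, ha, rfl⟩, by simpa [Nat.one_le_iff_ne_zero] using h⟩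
    · refine ⟨_, .inr ⟨a, b, hab, rfl⟩, fun c => ?_⟩
      have := hab.ne
      simp only [Finsupp.add_apply, Finsupp.single_apply]
      split_ifs <;> subst_vars <;> first | omega | contradiction

/-- Multiplying by `X y` completes an edge at `y` as soon as a neighbour of `y` divides the
monomial. If `y` were in `A`, the colon ideal would be everything. -/
theorem mem_edgeVarIdeal_union_neighborSet {G : SimpleGraph V} {A : Set V} {y : V} (hy : y ∉ A)
    (f : MvPolynomial V K) :
    f ∈ edgeVarIdeal K G (A ∪ G.neighborSet y) ↔ X y * f ∈ edgeVarIdeal K G A := by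
  classical
  rw [mem_edgeVarIdeal, mem_edgeVarIdeal, support_X_mul, Finset.forall_mem_map]
  refine forall₂_congr fun d _ => ?_
  have hd (a : V) : (Finsupp.single y 1 + d : V →₀ ℕ) a ≠ 0 ↔ a = y ∨ d a ≠ 0 := by
    by_cases h : a = y <;> simp [h]
  simp only [addLeftEmbedding_apply, hd, Set.mem_union, SimpleGraph.mem_neighborSet]
  constructor
  · rintro (⟨a, ha | ha, h⟩ | ⟨a, b, hab, ha, hb⟩)
    · exact .inl ⟨a, ha, .inr h⟩
    · exact .inr ⟨y, a, ha, .inl rfl, .inr h⟩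
    · exact .inr ⟨a, b, hab, .inr ha, .inr hb⟩
  · rintro (⟨a, ha, rfl | h⟩ | ⟨a, b, hab, rfl | ha, rfl | hb⟩)
    · exact absurd ha hy
    · exact .inl ⟨a, .inl ha, h⟩
    · exact absurd rfl hab.ne
    · exact .inl ⟨b, .inr hab, hb⟩
    · exact .inl ⟨a, .inr hab.symm, ha⟩
    · exact .inr ⟨a, b, hab, ha, hb⟩

theorem edgeVarIdeal_insert (G : SimpleGraph V) (A : Set V) (y : V) :
    edgeVarIdeal K G (insert y A) = edgeVarIdeal K G A ⊔ Ideal.span {X y} := by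
  rw [edgeVarIdeal, Set.image_insert_eq, Set.insert_union, Ideal.span_insert, sup_comm,
    edgeVarIdeal]

theorem edgeVarIdeal_bot (A : Set V) :
    edgeVarIdeal K (⊥ : SimpleGraph V) A = Ideal.span (X '' A) := by
  simp [edgeVarIdeal]

/-- If every edge of `G` meets `A`, then the edges of `G` are redundant. -/
theorem edgeVarIdeal_eq_bot_of_cover {G : SimpleGraph V} {A : Set V}
    (h : ∀ a b, G.Adj a b → a ∈ A ∨ b ∈ A) : edgeVarIdeal K G A = edgeVarIdeal K ⊥ A := by
  ext f
  simp only [mem_edgeVarIdeal]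
  refine forall₂_congr fun d _ => ⟨?_, ?_⟩
  · rintro (h' | ⟨a, b, hab, ha, hb⟩)
    · exact .inl h'
    · exact .inl ((h a b hab).elim (fun h => ⟨a, h, ha⟩) fun h => ⟨b, h, hb⟩)
  · rintro (h' | ⟨a, b, hab, -⟩)
    · exact .inl h'
    · exact hab.elim

/-- A nonempty non-face contains an edge, so its monomial is a multiple of an edge generator. -/
theorem stanleyReisnerIdeal_independenceComplex (G : SimpleGraph V) :
    stanleyReisnerIdeal K (independenceComplex G) = edgeVarIdeal K G ∅ := by
  classical
  rw [stanleyReisnerIdeal, edgeVarIdeal, Set.image_empty, Set.empty_union]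
  refine le_antisymm (Ideal.span_le.2 ?_) (Ideal.span_mono ?_)
  · rintro _ ⟨F, hF, hF', rfl⟩
    obtain ⟨a, ha, b, hb, -, hab⟩ : ∃ a ∈ F, ∃ b ∈ F, a ≠ b ∧ G.Adj a b := by
      by_contra! h
      exact hF' ⟨hF, fun a ha b hb hne => h a ha b hb hne⟩
    rw [← Finset.mul_prod_erase F _ ha,
      ← Finset.mul_prod_erase (F.erase a) _ (Finset.mem_erase.2 ⟨hab.ne', hb⟩), ← mul_assoc]
    exact Ideal.mul_mem_right _ _ (Ideal.subset_span ⟨a, b, hab, rfl⟩)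
  · rintro _ ⟨a, b, hab, rfl⟩
    refine ⟨{a, b}, by simp, fun h => ?_, (Finset.prod_pair hab.ne).symm⟩
    exact h.2 (by simp) (by simp) hab.ne hab

theorem hasProjectiveDimensionLE_quotient_span_X (A : Finset V) :
    HasProjectiveDimensionLE (ModuleCat.of (MvPolynomial V K)
      (MvPolynomial V K ⧸ edgeVarIdeal K (⊥ : SimpleGraph V) A)) A.card := by
  classical
  induction A using Finset.induction_on with
  | empty =>
    rw [Finset.card_empty, ← projective_iff_hasProjectiveDimensionLE_zero,
      ← IsProjective.iff_projective]
    exact Module.Projective.of_equiv (Submodule.quotEquivOfEqBot _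
      (by simp [edgeVarIdeal_bot])).symm
  -- Without edges the colon by `X y` changes nothing, so the first two terms of the sequence agree
  -- and the bound grows by one.
  | insert y A hy ih =>
    have hc : ∀ f, f ∈ edgeVarIdeal K (⊥ : SimpleGraph V) A ↔
        X y * f ∈ edgeVarIdeal K (⊥ : SimpleGraph V) A := fun f => by
      simpa using mem_edgeVarIdeal_union_neighborSet (G := ⊥) (A := (A : Set V))
        (by simpa using hy) f
    rw [Finset.card_insert_of_notMem hy]
    rw [Finset.coe_insert]
    have ih' := hasProjectiveDimensionLT_of_ge (ModuleCat.of (MvPolynomial V K)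
      (MvPolynomial V K ⧸ edgeVarIdeal K (⊥ : SimpleGraph V) A)) (A.card + 1) (A.card + 2) (by omega)
    have hS := colonShortComplex_shortExact hc (edgeVarIdeal_insert ⊥ (A : Set V) y)
    exact hS.hasProjectiveDimensionLT_X₃ (A.card + 1) ih ih'

theorem hasProjectiveDimensionLT_quotient_edgeVarIdeal [Fintype V] (G : SimpleGraph V)
    (A : Finset V) (hA : A ≠ Finset.univ) :
    HasProjectiveDimensionLT (ModuleCat.of (MvPolynomial V K)
      (MvPolynomial V K ⧸ edgeVarIdeal K G A)) (Fintype.card V) := by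
  classical
  induction h : Aᶜ.card using Nat.strong_induction_on generalizing A with
  | _ m ih =>
    subst h
    by_cases hcov : ∀ a b, G.Adj a b → a ∈ (A : Set V) ∨ b ∈ (A : Set V)
    · rw [edgeVarIdeal_eq_bot_of_cover hcov]
      have := hasProjectiveDimensionLE_quotient_span_X (K := K) A
      exact hasProjectiveDimensionLT_of_ge _ (A.card + 1) _ (Finset.card_lt_iff_ne_univ A |>.2 hA)
    · push Not at hcov
      obtain ⟨y, z, hyz, hy, hz⟩ := hcov
      -- Here `b` witnesses strict growth and `c` properness: `A ∪ N(y)` gains `z` and misses `y`,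
      -- while `insert y A` gains `y` and misses `z`.
      have hstep (B : Finset V) (hAB : A ⊆ B) {b c : V} (hb : b ∈ B) (hb' : b ∉ A) (hc : c ∉ B) :
          HasProjectiveDimensionLT (ModuleCat.of (MvPolynomial V K)
            (MvPolynomial V K ⧸ edgeVarIdeal K G B)) (Fintype.card V) :=
        ih _ (Finset.card_lt_card (Finset.compl_ssubset_compl.2
          (Finset.ssubset_iff_of_subset hAB |>.2 ⟨b, hb, hb'⟩))) B
          (fun h => hc (h ▸ Finset.mem_univ c)) rfl
      have h₁ := hstep (A ∪ G.neighborFinset y) Finset.subset_union_left (b := z) (c := y)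
        (by simp [hyz]) hz (by simpa using hy)
      have h₃ := hstep (insert y A) (Finset.subset_insert _ _) (b := y) (c := z) (by simp) hy
        (by simpa [hyz.ne'] using hz)
      rw [Finset.coe_union, SimpleGraph.coe_neighborFinset] at h₁
      rw [Finset.coe_insert] at h₃
      exact (colonShortComplex_shortExact (mem_edgeVarIdeal_union_neighborSet hy)
        (edgeVarIdeal_insert G A y)).hasProjectiveDimensionLT_X₂ _ h₁ h₃

theorem isWeaklyRegular_map_X {l : List V} (hl : l.Nodup) :
    RingTheory.Sequence.IsWeaklyRegular (MvPolynomial V K)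
      (l.map (X : V → MvPolynomial V K)) := by
  refine ⟨fun i hi => ?_⟩
  have hi' : i < l.length := by simpa using hi
  have hI : (Ideal.ofList ((l.map (X : V → MvPolynomial V K)).take i) • ⊤ :
      Ideal (MvPolynomial V K)) = edgeVarIdeal K ⊥ {a | a ∈ l.take i} := by
    rw [smul_eq_mul, Ideal.mul_top, edgeVarIdeal_bot, Ideal.ofList, ← List.map_take]
    congr 1
    ext p
    simp [-List.map_take, Set.mem_image, List.mem_map]
  rw [hI, isSMulRegular_quotient_iff_mem_of_smul_mem]
  intro f hf
  have hmem : l[i] ∉ ({a | a ∈ l.take i} : Set V) := by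
    intro h
    obtain ⟨j, hj, hj'⟩ := List.mem_take_iff_getElem.1 h
    have := (hl.getElem_inj_iff).1 hj'
    omega
  rw [List.getElem_map] at hf
  simpa using (mem_edgeVarIdeal_union_neighborSet (G := ⊥) hmem f).2 hf

end EdgeIdeal

section FullVertex

universe u v

variable (K : Type*) [Field K] {V : Type*}

/-- The ideal of the point of affine space whose only nonzero coordinate is `1` at `x`. -/
noncomputable def unitPointIdeal (x : V) : Ideal (MvPolynomial V K) :=
  open Classical in RingHom.ker (aeval (Pi.single x 1 : V → K)).toRingHom

instance (x : V) : (unitPointIdeal K x).IsPrime :=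
  RingHom.ker_isPrime _

variable {K}

theorem X_mem_unitPointIdeal {x y : V} (h : y ≠ x) :
    (X y : MvPolynomial V K) ∈ unitPointIdeal K x := by
  simp [unitPointIdeal, RingHom.mem_ker, h]

theorem X_notMem_unitPointIdeal (x : V) : (X x : MvPolynomial V K) ∉ unitPointIdeal K x := by
  simp [unitPointIdeal, RingHom.mem_ker]

/-- Inverting a full-vertex turns the edge ideal into the ideal of the remaining variables. -/
theorem map_edgeVarIdeal_of_isUniversal {S : Type*} [CommRing S] [Algebra (MvPolynomial V K) S]
    {G : SimpleGraph V} {x : V} (hx : G.IsUniversal x)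
    (hu : IsUnit (algebraMap (MvPolynomial V K) S (X x))) :
    (edgeVarIdeal K G ∅).map (algebraMap (MvPolynomial V K) S) =
      (Ideal.span (X '' {x}ᶜ)).map (algebraMap (MvPolynomial V K) S) := by
  refine le_antisymm (Ideal.map_mono (Ideal.span_le.2 ?_)) (Ideal.map_le_iff_le_comap.2
    (Ideal.span_le.2 ?_))
  · rintro _ (⟨_, h, -⟩ | ⟨a, b, hab, rfl⟩)
    · exact h.elim
    · by_cases ha : a = x
      · exact Ideal.mul_mem_left _ _ (Ideal.subset_span ⟨b, fun hb => hab.ne (ha.trans hb.symm), rfl⟩)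
      · exact Ideal.mul_mem_right _ _ (Ideal.subset_span ⟨a, ha, rfl⟩)
  · rintro _ ⟨y, hy, rfl⟩
    refine Ideal.mem_comap.2 ((Ideal.unit_mul_mem_iff_mem _ hu).1 ?_)
    rw [← map_mul]
    exact Ideal.mem_map_of_mem _ (Ideal.subset_span (.inr ⟨x, y, hx (Ne.symm hy), rfl⟩))

/-- Localization commutes with passing to quotients by ideals. -/
noncomputable def localizedModuleQuotientEquiv {R : Type*} [CommRing R] (T : Submonoid R)
    (I : Ideal R) :
    LocalizedModule T (R ⧸ I) ≃ₗ[Localization T]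
      Localization T ⧸ I.map (algebraMap R (Localization T)) :=
  LinearEquiv.extendScalarsOfIsLocalization T (Localization T)
    (IsLocalizedModule.linearEquiv T (LocalizedModule.mkLinearMap T (R ⧸ I))
      (Submodule.toLocalizedQuotient' (Localization T) T
        (Algebra.linearMap R (Localization T)) I)) ≪≫ₗ
    Submodule.quotEquivOfEq _ _ (Ideal.localized'_eq_map (Localization T) T I)

theorem card_sub_one_le_projectiveDimension {K : Type u} [Field K] {V : Type v} [Fintype V]
    {G : SimpleGraph V} {x : V}
    (hx : G.IsUniversal x) :
    ((Fintype.card V - 1 : ℕ) : WithBot ℕ∞) ≤ projectiveDimension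
      (ModuleCat.of (MvPolynomial V K) (MvPolynomial V K ⧸ edgeVarIdeal K G ∅)) := by
  classical
  -- `P` contains the other variables, so their sequence stays regular, and avoids `X x`, which
  -- becomes a unit.
  let P := unitPointIdeal K x
  let l := (Finset.univ.erase x).toList
  let rs := (l.map (X : V → MvPolynomial V K)).map
    (algebraMap (MvPolynomial V K) (Localization P.primeCompl))
  have hlen : rs.length = Fintype.card V - 1 := by simp [rs, l]
  have : IsLocalRing (Localization P.primeCompl) :=
    inferInstanceAs (IsLocalRing (Localization.AtPrime P))
  have hreg : RingTheory.Sequence.IsRegular (Localization P.primeCompl) rs := by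
    refine (isWeaklyRegular_map_X (Finset.nodup_toList _)).isRegular_of_isLocalization_of_mem _ P
      fun r hr => ?_
    obtain ⟨y, hy, rfl⟩ := List.mem_map.1 hr
    exact X_mem_unitPointIdeal (by simpa [l] using hy)
  have hI : (edgeVarIdeal K G ∅).map (algebraMap _ (Localization P.primeCompl)) =
      Ideal.ofList rs := by
    rw [map_edgeVarIdeal_of_isUniversal hx (IsLocalization.map_units _
      (⟨X x, X_notMem_unitPointIdeal x⟩ : P.primeCompl)), ← Ideal.map_ofList]
    congr 2
    ext p
    simp [l]
  rw [← hlen, ← ModuleCat.projectiveDimension_quotient_eq_length.{max u v} rs hreg,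
    ← ModuleCat.projectiveDimension_eq_of_linearEquiv
      (M := (ModuleCat.of (MvPolynomial V K)
        (MvPolynomial V K ⧸ edgeVarIdeal K G ∅)).localizedModule P.primeCompl)
      (Shrink.linearEquiv _ _ ≪≫ₗ localizedModuleQuotientEquiv P.primeCompl _ ≪≫ₗ
        Submodule.quotEquivOfEq _ _ hI ≪≫ₗ (Shrink.linearEquiv _ _).symm)]
  exact ModuleCat.projectiveDimension_le_projectiveDimension_of_isLocalizedModule _ _

end FullVertex

theorem mainTheorem2 (K : Type*) [Field K] {V : Type*} [Fintype V]
    (G : SimpleGraph V) [DecidableRel G.Adj] (x : V) (hx : G.IsUniversal x) :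
    pdimStanleyReisner K (independenceComplex G) = ((G.maxDegree : ℕ) : WithBot ℕ∞) ∧
      G.maxDegree = Fintype.card V - 1 := by
  have : Nonempty V := ⟨x⟩
  have hdeg : G.maxDegree = Fintype.card V - 1 :=
    le_antisymm (Nat.le_sub_one_of_lt G.maxDegree_lt_card_verts)
      (((G.degree_eq_card_sub_one x).2 hx).symm.trans_le (G.degree_le_maxDegree x))
  refine ⟨?_, hdeg⟩
  rw [hdeg]
  unfold pdimStanleyReisner StanleyReisnerRing
  rw [stanleyReisnerIdeal_independenceComplex]
  refine le_antisymm ?_ (card_sub_one_le_projectiveDimension hx)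
  -- `≤ n - 1` unfolds to `< (n - 1) + 1`, which is `< n` because `V` is nonempty.
  rw [projectiveDimension_le_iff, HasProjectiveDimensionLE,
    Nat.sub_add_cancel (Fintype.card_pos (α := V)), ← Finset.coe_empty]
  exact hasProjectiveDimensionLT_quotient_edgeVarIdeal G ∅ Finset.univ_nonempty.ne_empty.symm
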